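/- Let $p$ be an odd prime, let $V$ be a vector space of finite dimension $2n$ over $\mathbf F_p$, and let $f\colon V\times V\to\mathbf F_p$ be a nondegenerate alternating bilinear form. Let $E(f)=V\times\mathbf F_p$ be the group with multiplication $(x_1,z_1)(x_2,z_2)=(x_1+x_2,\,z_1+z_2+f(x_1,x_2))$, and let $G(f)$ be the group of all $g\in\mathrm{GL}(V)$ (acting on the right, so $x(gh)=(xg)h$) with $f(xg,yg)=f(x,y)$ for all $x,y\in V$, i.e. $G(f)=\mathrm{Sp}(V)$. Let $K'$ be a field containing a primitive $p$-th root of unity $\epsilon$, write $\exp(t)=\epsilon^t$ for $t\in\mathbf F_p$, let $V'$ be a $K'$-space of dimension $p^n$, and let $\rho\colon E(f)\to\mathrm{GL}(V')$ be an absolutely irreducible representation with $\rho(0,z)=\exp(z)\cdot 1$ for all $z\in\mathbf F_p$. For $g\in G(f)$ put $$s(g)=|V|^{-1}\sum_{y\in V}\rho(y,0)\rho(yg,0)^{-1},\qquad I(g)=V(1-g),\qquad i(g)=\dim I(g),$$ and let $f_g$ be the (well-defined) bilinear form on $I(g)$ with $f_g(x,y)=f(u,y)$ whenever $x=u(1-g)$.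 For $g,h\in G(f)$ let $$\sigma(g,h)=|I(g)|^{-1}|I(h)|^{-1}|I(gh)|\sum_{x\in I(g)\cap I(h^{-1})}\exp\bigl(f_g(x,x)-f_{h^{-1}}(x,x)\bigr).$$ Let $\chi$ be the quadratic character of $\mathbf F_p$, let $\delta_g=\chi(\det M)$ where $M$ is the matrix of $f_g$ relative to any basis of $I(g)$ (with $\det M=1$ if $I(g)=0$), let $\theta=\sum_{a\in\mathbf F_p}\exp(a^2)$, and define $\mu\colon G(f)\to K'$ by $$\mu(g)=|I(g)|^{-1}\theta^{i(g)}\delta_g .$$ Then every $s(g)$ is invertible and $\sigma$ is the factor set of the projective representation $s$ of $G(f)$, that is, $s(g)s(h)=\sigma(g,h)s(gh)$ for all $g,h\in G(f)$; and $\mu$ splits $\sigma$, that is, $\mu(g)\neq0$ for all $g\in G(f)$ and $$\sigma(g,h)=\mu(g)\mu(h)\mu(gh)^{-1}\qquad\text{for all }g,h\in G(f).$$ Furthermore, if $\eta'$ is an automorphism of $K'$ with $\epsilon^{\eta'}=\epsilon^{-1}$, then $\mu(g)=\mu(g^{-1})^{\eta'}$ for all $g\in G(f)$. -/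

import Mathlib

universe u

namespace Weil

open scoped TensorProduct

noncomputable section

variable {p : ℕ} {V : Type*} [AddCommGroup V] [Module (ZMod p) V]

/-- The group `E(f) = V × F_p` with `(x₁, z₁)(x₂, z₂) = (x₁ + x₂, z₁ + z₂ + f(x₁, x₂))`. -/
@[ext]
structure Extraspecial (f : LinearMap.BilinForm (ZMod p) V) where
  vec : V
  cen : ZMod p

namespace Extraspecial

variable {f : LinearMap.BilinForm (ZMod p) V}

instance : Mul (Extraspecial f) := ⟨fun a b => ⟨a.vec + b.vec, a.cen + b.cen + f a.vec b.vec⟩⟩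

instance : One (Extraspecial f) := ⟨⟨0, 0⟩⟩

instance : Inv (Extraspecial f) := ⟨fun a => ⟨-a.vec, -a.cen + f a.vec a.vec⟩⟩

@[simp] theorem mul_vec (a b : Extraspecial f) : (a * b).vec = a.vec + b.vec := rfl
@[simp] theorem mul_cen (a b : Extraspecial f) :
    (a * b).cen = a.cen + b.cen + f a.vec b.vec := rfl
@[simp] theorem one_vec : (1 : Extraspecial f).vec = 0 := rfl
@[simp] theorem one_cen : (1 : Extraspecial f).cen = 0 := rfl
@[simp] theorem inv_vec (a : Extraspecial f) : (a⁻¹).vec = -a.vec := rfl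
@[simp] theorem inv_cen (a : Extraspecial f) : (a⁻¹).cen = -a.cen + f a.vec a.vec := rfl

instance : Group (Extraspecial f) :=
  Group.ofLeftAxioms
    (fun a b c => by
      ext
      · simp [add_assoc]
      · simp; ring)
    (fun a => by ext <;> simp)
    (fun a => by ext <;> simp)

end Extraspecial

/-- The group `G(f)` of all `F_p`-linear automorphisms of `V` that preserve `f`. Its elements act
on `V` from the right, which is why it is a subgroup of the opposite of `V ≃ₗ V`:
`x g` is `g.unop x`, and `x (g h) = (x g) h`. -/
def isometryGroup (f : LinearMap.BilinForm (ZMod p) V) : Subgroup (V ≃ₗ[ZMod p] V)ᵐᵒᵖ where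
  carrier := {g | ∀ x y, f (g.unop x) (g.unop y) = f x y}
  mul_mem' := by
    intro g h hg hh x y
    simp only [Set.mem_ofPred_eq] at hg hh
    simp [hg, hh]
  one_mem' := by intro x y; simp
  inv_mem' := by
    intro g hg x y
    simp only [Set.mem_ofPred_eq] at hg
    rw [← hg]
    simp [MulOpposite.unop_inv, LinearEquiv.coe_inv]

variable {f : LinearMap.BilinForm (ZMod p) V}

/-- The right action `x ↦ x g` of `g ∈ G(f)` on `V`. -/
def act (g : isometryGroup f) : V →ₗ[ZMod p] V := (g.1.unop : V →ₗ[ZMod p] V)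

theorem act_preserves (g : isometryGroup f) (x y : V) : f (act g x) (act g y) = f x y := g.2 x y

theorem act_mul (g h : isometryGroup f) (x : V) : act (g * h) x = act h (act g x) := rfl

/-- `I(g)`, the image of `1 - g`. -/
abbrev image (g : isometryGroup f) : Submodule (ZMod p) V :=
  LinearMap.range (LinearMap.id - act g)

/-- `i(g) = dim I(g)`. -/
def imageDim (g : isometryGroup f) : ℕ := Module.finrank (ZMod p) (image g)

theorem ker_le (g : isometryGroup f) :
    LinearMap.ker (LinearMap.id - act g) ≤ LinearMap.ker (f.compl₂ (image g).subtype) := by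
  intro x hx
  rw [LinearMap.mem_ker, LinearMap.sub_apply, LinearMap.id_apply, sub_eq_zero] at hx
  rw [LinearMap.mem_ker]
  ext ⟨_, v, rfl⟩
  have h := act_preserves g x v
  rw [← hx] at h
  simp [h]

/-- The form `f_g` on `I(g)`: `f_g(u(1 - g), y) = f(u, y)`. -/
def wallForm (g : isometryGroup f) : LinearMap.BilinForm (ZMod p) (image g) :=
  ((LinearMap.ker (LinearMap.id - act g)).liftQ (f.compl₂ (image g).subtype) (ker_le g)).comp
    (LinearMap.id - act g).quotKerEquivRange.symm.toLinearMap

/-- The defining property of `f_g`. -/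
theorem wallForm_apply (g : isometryGroup f) (u : V) (x y : image g)
    (hx : (x : V) = u - act g u) : wallForm g x y = f u y := by
  have hx' : x = ⟨(LinearMap.id - act g : V →ₗ[ZMod p] V) u, ⟨u, rfl⟩⟩ := Subtype.ext hx
  subst hx'
  simp only [wallForm, LinearMap.comp_apply, LinearEquiv.coe_coe]
  erw [LinearMap.quotKerEquivRange_symm_apply_image]
  simp

/-- `δ_g = χ(det M)`, with `χ` the quadratic character of `F_p` and `M` the matrix of `f_g`
relative to a basis of `I(g)`; `wallSign_eq` shows that the basis does not matter. -/
def wallSign [Fact p.Prime] [Finite V] (g : isometryGroup f) : ℤ :=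
  quadraticChar (ZMod p)
    (LinearMap.BilinForm.toMatrix (Module.finBasis (ZMod p) (image g)) (wallForm g)).det

theorem wallSign_eq [Fact p.Prime] [Finite V] (g : isometryGroup f) {ι : Type*} [Fintype ι]
    [DecidableEq ι] (b : Module.Basis ι (ZMod p) (image g)) :
    wallSign g =
      quadraticChar (ZMod p) (LinearMap.BilinForm.toMatrix b (wallForm g)).det := by
  classical
  let c := Module.finBasis (ZMod p) (image g)
  let e : ι ≃ Fin (Module.finrank (ZMod p) (image g)) := b.indexEquiv c
  let b' := b.reindex e
  have h1 : (LinearMap.BilinForm.toMatrix b' (wallForm g)).det =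
      (LinearMap.BilinForm.toMatrix b (wallForm g)).det := by
    rw [← Matrix.det_submatrix_equiv_self e.symm]
    congr 1
    ext i j
    simp [b', LinearMap.BilinForm.toMatrix_apply]
  have h2 := congrArg Matrix.det
    (LinearMap.BilinForm.toMatrix_mul_basis_toMatrix (b := c) b' (wallForm g))
  rw [Matrix.det_mul, Matrix.det_mul, Matrix.det_transpose, h1] at h2
  have h3 : (c.toMatrix b').det ≠ 0 := by
    have h := congrArg Matrix.det (c.toMatrix_mul_toMatrix_flip b')
    rw [Matrix.det_mul, Matrix.det_one] at h
    exact left_ne_zero_of_mul_eq_one h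
  rw [← h2, mul_right_comm, map_mul, ← pow_two, quadraticChar_sq_one' h3, one_mul]
  rfl

variable {K : Type*} [Field K]

/-- `exp t = ε ^ t` for `t ∈ F_p`. -/
def expo (ε : K) (t : ZMod p) : K := ε ^ t.val

/-- The quadratic Gauss sum `θ = ∑_{a ∈ F_p} exp (a ^ 2)`. -/
def gaussSum (p : ℕ) [Fact p.Prime] (ε : K) : K := ∑ a : ZMod p, expo ε (a ^ 2)

/-- `μ(g) = |I(g)|⁻¹ θ ^ i(g) δ_g`. -/
def splitting [Fact p.Prime] [Finite V] (ε : K) (g : isometryGroup f) : K :=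
  (Nat.card (image g) : K)⁻¹ * gaussSum p ε ^ imageDim g * (wallSign g : K)

/-- The form `γ_{g,h} = f_g - f_{h⁻¹}` on `I(g) ∩ I(h⁻¹)`, evaluated at `(u, v)`. -/
def gammaForm (g h : isometryGroup f) (u v : ↥(image g ⊓ image h⁻¹)) : ZMod p :=
  wallForm g ⟨u, u.2.1⟩ ⟨v, v.2.1⟩ - wallForm h⁻¹ ⟨u, u.2.2⟩ ⟨v, v.2.2⟩

/-- The factor set
`σ(g,h) = |I(g)|⁻¹ |I(h)|⁻¹ |I(gh)| ∑_{x ∈ I(g) ∩ I(h⁻¹)} exp (γ_{g,h}(x,x))`. -/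
def factorSet (ε : K) (g h : isometryGroup f) : K :=
  (Nat.card (image g) : K)⁻¹ * (Nat.card (image h) : K)⁻¹ * (Nat.card (image (g * h)) : K) *
    ∑ᶠ x : ↥(image g ⊓ image h⁻¹), expo ε (gammaForm g h x x)

variable {V' : Type*} [AddCommGroup V'] [Module K V']

/-- `s(g) = |V|⁻¹ ∑_{y ∈ V} ρ(y, 0) ρ(yg, 0)⁻¹`. -/
def weilOp [Fintype V] (ρ : Representation K (Extraspecial f) V') (g : isometryGroup f) :
    Module.End K V' :=
  (Fintype.card V : K)⁻¹ • ∑ y : V, ρ ⟨y, 0⟩ * ρ (⟨act g y, 0⟩ : Extraspecial f)⁻¹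

end

/-- The representation on `L ⊗ V'` obtained from `ρ` by extension of scalars. -/
noncomputable def extendScalars {K G V' : Type*} [Field K] [Group G] [AddCommGroup V']
    [Module K V'] (L : Type*) [Field L] [Algebra K L] (ρ : Representation K G V') :
    Representation L G (L ⊗[K] V') :=
  (Module.End.baseChangeHom K L V' : Module.End K V' →* Module.End L (L ⊗[K] V')).comp ρ

/-- `ρ` is absolutely irreducible: it stays irreducible over every extension field (it suffices
to let the extension run over one universe, as that contains an algebraic closure). -/
def IsAbsolutelyIrreducible {K : Type u} {G V' : Type*} [Field K] [Group G] [AddCommGroup V']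
    [Module K V'] (ρ : Representation K G V') : Prop :=
  ∀ (L : Type u) [Field L] [Algebra K L], (extendScalars L ρ).IsIrreducible

end Weil

/-! Write `ψ t = ε ^ t`. Substituting `x = y (1 - g)` in the definition of `s(g)` gives
`s(g) = |I(g)|⁻¹ ∑ ψ(f_g(x, x)) ρ(x, 0)`, the sum running over `x ∈ I(g)`. Hence `s(g) s(h)` is, up
to the cardinalities, `∑ ψ(B(a, a)) ρ(a₁ + a₂, 0)` over `a ∈ I(g) × I(h)`, where `B` is a
nondegenerate form with `B(a, b) - B(b, a) = f(a₁ + a₂, b₁ + b₂)`; in particular `B` is symmetric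
against the kernel `N` of the addition map, a copy of `I(g) ∩ I(h⁻¹)`. Addition maps the
orthogonal space of `N` onto `I(gh)` and carries `B` to `f_{gh}`.

Let `R = N ∩ N^⊥`. Summing first over the cosets of `R` kills everything outside `R^⊥ = N + N^⊥`, so
that the sum factors as `∑_N ψ(B(a, a))` times the sum for `f_{gh}`; this is the factor set. The
weights `θ ^ dim W * χ(det B)` obey the same reduction: on a complement of `R` in `N` the form is
symmetric and nondegenerate, so its Gauss sum equals its weight, and a hyperbolic plane has weight
`χ(-1) θ ^ 2 = p`. As the weight of `B` is the product of those of `f_g` and `f_h`, the function `μ`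
splits the factor set. -/

namespace Weil

section Gauss

variable {F K : Type*} [Field F] [Fintype F] [Field K]

/-- The quadratic Gauss sum `θ = ∑_{a ∈ F} ψ (a ^ 2)` of an additive character `ψ`. -/
def quadraticGaussSum (ψ : AddChar F K) : K := ∑ a : F, ψ (a ^ 2)

variable {ψ : AddChar F K}

theorem quadraticGaussSum_eq_gaussSum [DecidableEq F] (hF : ringChar F ≠ 2) (hψ : ψ ≠ 1) :
    quadraticGaussSum ψ =
      _root_.gaussSum ((quadraticChar F).ringHomComp (Int.castRingHom K)) ψ := by
  have fiber (t : F) : ∑ a : F with a ^ 2 = t, ψ (a ^ 2) = ψ t + quadraticChar F t * ψ t := by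
    have card_fiber := quadraticChar_card_sqrts hF t
    rw [Set.toFinset_ofPred] at card_fiber
    have := congrArg (Int.cast : ℤ → K) card_fiber
    push_cast at this
    rw [Finset.sum_congr rfl fun a ha => congrArg ψ (Finset.mem_filter.1 ha).2,
      Finset.sum_const, nsmul_eq_mul, this]
    ring
  rw [quadraticGaussSum, ← Finset.sum_fiberwise_of_maps_to fun a _ => Finset.mem_univ (a ^ 2)]
  simp only [fiber, Finset.sum_add_distrib, AddChar.sum_eq_zero_of_ne_one hψ, zero_add]
  rfl

theorem quadraticChar_cast_sq [DecidableEq F] {c : F} (hc : c ≠ 0) :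
    (quadraticChar F c : K) ^ 2 = 1 := by
  exact_mod_cast congrArg (Int.cast : ℤ → K) (quadraticChar_sq_one hc)

theorem quadraticGaussSum_mulShift [DecidableEq F] (hF : ringChar F ≠ 2) (hψ : ψ.IsPrimitive)
    {c : F} (hc : c ≠ 0) :
    quadraticGaussSum (ψ.mulShift c) = quadraticChar F c * quadraticGaussSum ψ := by
  have h := gaussSum_mulShift ((quadraticChar F).ringHomComp (Int.castRingHom K)) ψ (Units.mk0 c hc)
  rw [Units.val_mk0, ← quadraticGaussSum_eq_gaussSum hF (hψ hc),
    ← quadraticGaussSum_eq_gaussSum hF (by simpa using hψ one_ne_zero),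
    MulChar.ringHomComp_apply, eq_intCast] at h
  rw [← h, ← mul_assoc, ← sq, quadraticChar_cast_sq hc, one_mul]

/-- Not an instance of `gaussSum_sq`: when `K` has characteristic two, the quadratic character
becomes trivial in `K`. -/
theorem quadraticChar_neg_one_mul_quadraticGaussSum_sq [DecidableEq F] (hF : ringChar F ≠ 2)
    (hψ : ψ.IsPrimitive) :
    (quadraticChar F (-1) : K) * quadraticGaussSum ψ ^ 2 = Fintype.card F := by
  have two_ne_zero : (2 : F) ≠ 0 := Ring.two_ne_zero hF
  have sum_translate (b : F) :
      ∑ a, ψ (a ^ 2) * ψ (-1 * b ^ 2) = ∑ a, ψ (a ^ 2) * ψ (b * (2 * a)) := by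
    refine Fintype.sum_equiv (Equiv.subRight b) _ _ fun a => ?_
    rw [← AddChar.map_add_eq_mul, ← AddChar.map_add_eq_mul, Equiv.subRight_apply]
    ring_nf
  calc (quadraticChar F (-1) : K) * quadraticGaussSum ψ ^ 2
      = quadraticGaussSum ψ * quadraticGaussSum (ψ.mulShift (-1)) := by
        rw [quadraticGaussSum_mulShift hF hψ (neg_ne_zero.2 one_ne_zero)]; ring
    _ = ∑ b, ∑ a, ψ (a ^ 2) * ψ (-1 * b ^ 2) := by
        rw [quadraticGaussSum, quadraticGaussSum, Finset.sum_mul_sum, Finset.sum_comm]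
        rfl
    _ = ∑ a, ψ (a ^ 2) * ∑ b, ψ (b * (2 * a)) := by
        simp only [sum_translate, Finset.mul_sum]
        exact Finset.sum_comm
    _ = Fintype.card F := by
        simp [AddChar.sum_mulShift _ hψ, two_ne_zero]

theorem quadraticGaussSum_ne_zero (hF : ringChar F ≠ 2) (hψ : ψ.IsPrimitive)
    (hK : (Fintype.card F : K) ≠ 0) : quadraticGaussSum ψ ≠ 0 := by
  classical
  intro h
  have := quadraticChar_neg_one_mul_quadraticGaussSum_sq hF hψ
  rw [h, zero_pow two_ne_zero, mul_zero] at this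
  exact hK this.symm

end Gauss

theorem addChar_sum {A M ι : Type*} [AddCommMonoid A] [CommMonoid M] (φ : AddChar A M)
    (s : Finset ι) (a : ι → A) : φ (∑ i ∈ s, a i) = ∏ i ∈ s, φ (a i) :=
  map_sum φ.toAddMonoidHom a s

section Sup

variable {F W : Type*} [Field F] [AddCommGroup W] [Module F W] {P Q : Submodule F W}

/-- The sum of two subspaces with trivial intersection, as a product. -/
noncomputable def prodEquivSup (hPQ : Disjoint P Q) : (P × Q) ≃ₗ[F] ↥(P ⊔ Q) :=
  (LinearEquiv.ofInjective (P.subtype.coprod Q.subtype) (by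
    rw [← LinearMap.ker_eq_bot, LinearMap.ker_coprod_of_disjoint_range _ _ (by simpa using hPQ)]
    simp)).trans
  (LinearEquiv.ofEq _ _ (Submodule.sup_eq_range P Q).symm)

@[simp] theorem coe_prodEquivSup (hPQ : Disjoint P Q) (x : P × Q) :
    (prodEquivSup hPQ x : W) = x.1 + x.2 := rfl

theorem sum_sup {E : Type*} [AddCommMonoid E] [Fintype P] [Fintype Q] [Fintype ↥(P ⊔ Q)]
    (hPQ : Disjoint P Q) (Φ : W → E) :
    ∑ w : ↥(P ⊔ Q), Φ w = ∑ x : P, ∑ y : Q, Φ (x + y) := by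
  rw [← (prodEquivSup hPQ).toEquiv.sum_comp, Fintype.sum_prod_type]
  rfl

end Sup

section Discriminant

variable {F : Type*} [Field F] [Fintype F] [DecidableEq F]
variable {W : Type*} [AddCommGroup W] [Module F W] [FiniteDimensional F W]

/-- The quadratic character of the discriminant of a bilinear form, computed in the standard basis
of the space; `discSign_eq` shows that the basis does not matter. -/
noncomputable def discSign (B : LinearMap.BilinForm F W) : ℤ :=
  quadraticChar F (LinearMap.BilinForm.toMatrix (Module.finBasis F W) B).det

theorem discSign_eq (B : LinearMap.BilinForm F W) {ι : Type*} [Fintype ι] [DecidableEq ι]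
    (b : Module.Basis ι F W) :
    discSign B = quadraticChar F (LinearMap.BilinForm.toMatrix b B).det := by
  let c := Module.finBasis F W
  let b' := b.reindex (b.indexEquiv c)
  have det_reindex : (LinearMap.BilinForm.toMatrix b' B).det =
      (LinearMap.BilinForm.toMatrix b B).det := by
    rw [← Matrix.det_submatrix_equiv_self (b.indexEquiv c).symm]
    congr 1
    ext i j
    simp [b', LinearMap.BilinForm.toMatrix_apply]
  have det_change : (b'.det c) ^ 2 * (LinearMap.BilinForm.toMatrix b' B).det =
      (LinearMap.BilinForm.toMatrix c B).det := by
    rw [← LinearMap.BilinForm.toMatrix_mul_basis_toMatrix b' c B, Matrix.det_mul, Matrix.det_mul,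
      Matrix.det_transpose, Module.Basis.det_apply]
    ring
  rw [discSign, ← det_change, map_mul, quadraticChar_sq_one' (b'.isUnit_det c).ne_zero, one_mul,
    det_reindex]

theorem discSign_sq {B : LinearMap.BilinForm F W} (hB : B.Nondegenerate) : discSign B ^ 2 = 1 :=
  quadraticChar_sq_one ((LinearMap.BilinForm.nondegenerate_iff_det_ne_zero _).1 hB)

end Discriminant

section GaussWeight

variable {F K : Type*} [Field F] [Fintype F] [DecidableEq F] [Field K] {ψ : AddChar F K}
variable {W : Type*} [AddCommGroup W] [Module F W] [FiniteDimensional F W]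
  {B : LinearMap.BilinForm F W}

/-- The value `θ ^ dim W * χ(det B)` that the Gauss sum `∑ w, ψ (B w w)` has for a nondegenerate
symmetric form `B` (see `sum_apply_self_eq_gaussWeight`), defined for arbitrary `B`. -/
noncomputable def gaussWeight (ψ : AddChar F K) (B : LinearMap.BilinForm F W) : K :=
  quadraticGaussSum ψ ^ Module.finrank F W * discSign B

theorem gaussWeight_eq (ψ : AddChar F K) (B : LinearMap.BilinForm F W) {ι : Type*} [Fintype ι]
    [DecidableEq ι] (b : Module.Basis ι F W) :
    gaussWeight ψ B = quadraticGaussSum ψ ^ Fintype.card ι *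
      quadraticChar F (LinearMap.BilinForm.toMatrix b B).det := by
  rw [gaussWeight, discSign_eq B b, Module.finrank_eq_card_basis b]

theorem gaussWeight_ne_zero (hF : ringChar F ≠ 2) (hψ : ψ.IsPrimitive)
    (hK : (Fintype.card F : K) ≠ 0) (hB : B.Nondegenerate) : gaussWeight ψ B ≠ 0 := by
  refine mul_ne_zero (pow_ne_zero _ (quadraticGaussSum_ne_zero hF hψ hK)) fun h => ?_
  have := congrArg (Int.cast : ℤ → K) (discSign_sq hB)
  simp [h] at this

theorem gaussWeight_congr {U : Type*} [AddCommGroup U] [Module F U] [FiniteDimensional F U]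
    {C : LinearMap.BilinForm F U} (e : U ≃ₗ[F] W) (he : ∀ x y, B (e x) (e y) = C x y) :
    gaussWeight ψ B = gaussWeight ψ C := by
  have b := Module.finBasis F U
  rw [gaussWeight_eq ψ C b, gaussWeight_eq ψ B (b.map e)]
  congr 4
  ext i j
  simp [LinearMap.BilinForm.toMatrix_apply, he]

theorem map_gaussWeight {L : Type*} [Field L] (η : K →+* L) :
    η (gaussWeight ψ B) = gaussWeight ((η : K →* L).compAddChar ψ) B := by
  simp [gaussWeight, quadraticGaussSum]

theorem gaussWeight_inv_neg_flip (hF : ringChar F ≠ 2) (hψ : ψ.IsPrimitive) :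
    gaussWeight ψ⁻¹ (-B.flip) = gaussWeight ψ B := by
  have b := Module.finBasis F W
  have toMatrix_eq : LinearMap.BilinForm.toMatrix b (-B.flip) =
      -(LinearMap.BilinForm.toMatrix b B).transpose := by
    ext i j
    simp [LinearMap.BilinForm.toMatrix_apply]
  have sign_pow : (quadraticChar F (-1) : K) ^ Module.finrank F W *
      quadraticChar F (-1) ^ Module.finrank F W = 1 := by
    rw [← mul_pow, ← sq, quadraticChar_cast_sq (neg_ne_zero.2 one_ne_zero), one_pow]
  rw [gaussWeight_eq ψ⁻¹ _ b, gaussWeight_eq ψ B b, toMatrix_eq, Matrix.det_neg,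
    Matrix.det_transpose, AddChar.inv_mulShift,
    quadraticGaussSum_mulShift hF hψ (neg_ne_zero.2 one_ne_zero), map_mul, map_pow, mul_pow,
    Fintype.card_fin, Int.cast_mul, Int.cast_pow]
  linear_combination quadraticGaussSum ψ ^ Module.finrank F W *
    quadraticChar F (LinearMap.BilinForm.toMatrix b B).det * sign_pow

theorem gaussWeight_prod {P Q : Type*} [AddCommGroup P] [Module F P] [FiniteDimensional F P]
    [AddCommGroup Q] [Module F Q] [FiniteDimensional F Q] {B : LinearMap.BilinForm F (P × Q)}
    {C : LinearMap.BilinForm F P} {D : LinearMap.BilinForm F Q}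
    (hC : ∀ x y, B (x, 0) (y, 0) = C x y) (hD : ∀ x y, B (0, x) (0, y) = D x y)
    (horth : ∀ x y, B (0, y) (x, 0) = 0) :
    gaussWeight ψ B = gaussWeight ψ C * gaussWeight ψ D := by
  have b := Module.finBasis F P
  have c := Module.finBasis F Q
  have det_eq : (LinearMap.BilinForm.toMatrix (b.prod c) B).det =
      (LinearMap.BilinForm.toMatrix b C).det * (LinearMap.BilinForm.toMatrix c D).det := by
    rw [← Matrix.det_fromBlocks_zero₂₁ _ (Matrix.of fun i j => B (b i, 0) (0, c j))]
    congr 1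
    ext (i | i) (j | j) <;> simp [LinearMap.BilinForm.toMatrix_apply, hC, hD, horth]
  rw [gaussWeight_eq ψ B (b.prod c), gaussWeight_eq ψ C b, gaussWeight_eq ψ D c, det_eq,
    Fintype.card_sum, pow_add, map_mul, Int.cast_mul]
  ring

theorem gaussWeight_restrict_sup {P Q : Submodule F W} (hPQ : Disjoint P Q)
    (horth : ∀ x ∈ P, ∀ y ∈ Q, B y x = 0) :
    gaussWeight ψ (B.restrict (P ⊔ Q)) =
      gaussWeight ψ (B.restrict P) * gaussWeight ψ (B.restrict Q) := by
  let e := prodEquivSup hPQ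
  rw [gaussWeight_congr (C := (B.restrict (P ⊔ Q)).compl₁₂ e.toLinearMap e.toLinearMap) e
    fun _ _ => rfl]
  exact gaussWeight_prod (by simp [e]) (by simp [e]) fun x y => by simp [e, horth x x.2 y y.2]

theorem sum_apply_self_eq_gaussWeight [Fintype W] (hF : ringChar F ≠ 2) (hψ : ψ.IsPrimitive)
    (hB : B.Nondegenerate) (hsymm : B.IsSymm) : ∑ w, ψ (B w w) = gaussWeight ψ B := by
  have : Invertible (2 : F) := invertibleOfNonzero (Ring.two_ne_zero hF)
  obtain ⟨b, hb⟩ := LinearMap.BilinForm.exists_orthogonal_basis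
    (LinearMap.BilinForm.isSymm_iff.1 hsymm)
  have apply_self_ne_zero := hb.not_isOrtho_basis_self_of_separatingLeft hB.1
  have toMatrix_eq : LinearMap.BilinForm.toMatrix b B = Matrix.diagonal fun i => B (b i) (b i) := by
    ext i j
    obtain rfl | hij := eq_or_ne i j
    · simp [LinearMap.BilinForm.toMatrix_apply]
    · simpa [LinearMap.BilinForm.toMatrix_apply, hij] using hb hij
  have apply_equivFun_symm (a : Fin (Module.finrank F W) → F) :
      B (b.equivFun.symm a) (b.equivFun.symm a) = ∑ i, B (b i) (b i) * a i ^ 2 := by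
    simp only [Module.Basis.equivFun_symm_apply, map_sum, LinearMap.sum_apply, map_smul,
      LinearMap.smul_apply, smul_eq_mul]
    refine Finset.sum_congr rfl fun i _ => ?_
    rw [Finset.sum_eq_single i (fun j _ hj => by simp [show B (b j) (b i) = 0 from hb hj])
      (by simp)]
    ring
  calc ∑ w, ψ (B w w)
      = ∑ a : Fin (Module.finrank F W) → F, ∏ i, ψ (B (b i) (b i) * a i ^ 2) := by
        rw [← b.equivFun.symm.toEquiv.sum_comp]
        simp only [LinearEquiv.coe_toEquiv, apply_equivFun_symm, addChar_sum]
    _ = ∏ i, quadraticGaussSum (ψ.mulShift (B (b i) (b i))) := by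
        simp [quadraticGaussSum, AddChar.mulShift_apply, Finset.prod_univ_sum]
    _ = ∏ i, quadraticChar F (B (b i) (b i)) * quadraticGaussSum ψ :=
        Finset.prod_congr rfl fun i _ => quadraticGaussSum_mulShift hF hψ (apply_self_ne_zero i)
    _ = gaussWeight ψ B := by
        simp [gaussWeight_eq ψ B b, toMatrix_eq, Finset.prod_mul_distrib, mul_comm]

end GaussWeight

section HyperbolicMatrix

variable {R ι κ : Type*} [CommRing R] [Fintype ι] [DecidableEq ι] [Fintype κ] [DecidableEq κ]

open Matrix in
theorem det_fromBlocks_one_one_zero (X : Matrix ι ι R) :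
    (fromBlocks X (1 : Matrix ι ι R) (1 : Matrix ι ι R) 0).det = (-1) ^ Fintype.card ι := by
  have column_operation : fromBlocks X 1 1 0 * fromBlocks 1 0 (1 - X) 1 =
      (fromBlocks 1 1 1 0 : Matrix (ι ⊕ ι) (ι ⊕ ι) R) := by
    simp [fromBlocks_multiply]
  have h := congrArg det column_operation
  rwa [det_mul, det_fromBlocks_zero₁₂, det_one, mul_one, mul_one, det_fromBlocks_one₁₁, one_mul,
    zero_sub, det_neg, det_one, mul_one] at h

open Matrix in
theorem det_fromBlocks_hyperbolic (X : Matrix ι ι R) (Y : Matrix ι κ R) (Z : Matrix κ ι R)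
    (D : Matrix κ κ R) :
    (fromBlocks (fromBlocks X (1 : Matrix ι ι R) (1 : Matrix ι ι R) 0)
      (fromRows Y 0) (fromCols Z 0) D).det = (-1) ^ Fintype.card ι * D.det := by
  let H : Matrix (ι ⊕ ι) (ι ⊕ ι) R := fromBlocks X 1 1 0
  let J : Matrix (ι ⊕ ι) (ι ⊕ ι) R := fromBlocks 0 1 1 (-X)
  let _ : Invertible H := invertibleOfLeftInverse H J (by simp [H, J, fromBlocks_multiply])
  have schur_correction :
      fromCols Z (0 : Matrix κ ι R) * J * fromRows Y (0 : Matrix ι κ R) = 0 := by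
    simp [J, fromCols_mul_fromBlocks, fromCols_mul_fromRows]
  change (fromBlocks H _ _ _).det = _
  rw [det_fromBlocks₁₁, det_fromBlocks_one_one_zero, show ⅟H = J from rfl, schur_correction,
    sub_zero]

end HyperbolicMatrix

section Orthogonal

variable {F W : Type*} [Field F] [AddCommGroup W] [Module F W] [FiniteDimensional F W]
  {B : LinearMap.BilinForm F W}

theorem exists_forall_apply_eq (hB : B.Nondegenerate) {R : Submodule F W} (ξ : Module.Dual F R) :
    ∃ w, ∀ r : R, B r w = ξ r := by
  obtain ⟨η, hη⟩ := ξ.exists_extend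
  refine ⟨(B.flip.toDual hB.flip).symm η, fun r => ?_⟩
  rw [← LinearMap.BilinForm.flip_apply, LinearMap.BilinForm.apply_toDual_symm_apply, ← hη]
  rfl

theorem flip_orthogonal_orthogonal (hB : B.Nondegenerate) (L : Submodule F W) :
    B.flip.orthogonal (B.orthogonal L) = L := by
  refine (Submodule.eq_of_le_of_finrank_le (fun a ha m hm => hm a ha) ?_).symm
  rw [LinearMap.BilinForm.finrank_orthogonal hB.flip, LinearMap.BilinForm.finrank_orthogonal hB]
  have := L.finrank_le
  lia

theorem exists_hyperbolic_equiv (hB : B.Nondegenerate) {R U : Submodule F W}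
    (hdisj : Disjoint R U) (hsup : R ⊔ U = B.orthogonal R) :
    ∃ e : ((Module.Dual F R × R) × U) ≃ₗ[F] W,
      (∀ (r : R) (u : U), e ((0, r), u) = r + u) ∧ ∀ (r : R) x, B r (e x) = x.1.1 r := by
  let φ : W →ₗ[F] Module.Dual F R := B.flip.compl₂ R.subtype
  have ker_φ (w : W) : φ w = 0 ↔ w ∈ R ⊔ U := by
    rw [hsup, LinearMap.BilinForm.mem_orthogonal_iff, LinearMap.ext_iff]
    exact Subtype.forall
  obtain ⟨s, hs⟩ := φ.exists_rightInverse_of_surjective <| LinearMap.range_eq_top.2 fun ξ =>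
    (exists_forall_apply_eq hB ξ).imp fun w hw => LinearMap.ext hw
  have φ_s (ξ : Module.Dual F R) : φ (s ξ) = ξ := LinearMap.congr_fun hs ξ
  let a : ((Module.Dual F R × R) × U) →ₗ[F] W := (s.coprod R.subtype).coprod U.subtype
  have a_apply (ξ : Module.Dual F R) (r : R) (u : U) : a ((ξ, r), u) = s ξ + (r + u) :=
    add_assoc _ _ _
  have φ_a (ξ : Module.Dual F R) (r : R) (u : U) : φ (a ((ξ, r), u)) = ξ := by
    rw [a_apply, map_add, φ_s, (ker_φ _).2 (Submodule.add_mem_sup r.2 u.2), add_zero]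
  have a_injective : Function.Injective a := by
    rw [← LinearMap.ker_eq_bot, LinearMap.ker_eq_bot']
    rintro ⟨⟨ξ, r⟩, u⟩ h
    obtain rfl : ξ = 0 := by rw [← φ_a ξ r u, h, map_zero]
    rw [a_apply, map_zero, zero_add] at h
    obtain rfl : r = 0 := Subtype.ext <|
      Submodule.disjoint_def.1 hdisj r r.2 (by rw [eq_neg_of_add_eq_zero_left h]; simp)
    obtain rfl : u = 0 := by simpa using h
    rfl
  have a_surjective : Function.Surjective a := fun w => by
    have : w - s (φ w) ∈ R ⊔ U := by rw [← ker_φ, map_sub, φ_s, sub_self]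
    obtain ⟨r, hr, u, hu, h⟩ := Submodule.mem_sup.1 this
    exact ⟨((φ w, ⟨r, hr⟩), ⟨u, hu⟩), by rw [a_apply, h, add_sub_cancel]⟩
  refine ⟨LinearEquiv.ofBijective a ⟨a_injective, a_surjective⟩, fun r u => ?_, fun r x => ?_⟩
  · exact (a_apply 0 r u).trans (by rw [map_zero, zero_add])
  · exact LinearMap.congr_fun (φ_a x.1.1 x.1.2 x.2) r

end Orthogonal

section IsotropicReduction

variable {F K : Type*} [Field F] [Field K] {ψ : AddChar F K}

theorem sum_dual_apply {X : Type*} [AddCommGroup X] [Module F X] [Fintype X] (hψ : ψ.IsPrimitive)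
    (ξ : Module.Dual F X) [Decidable (ξ = 0)] :
    ∑ x, ψ (ξ x) = if ξ = 0 then (Nat.card X : K) else 0 := by
  split_ifs with hξ
  · simp [hξ]
  · obtain ⟨x₀, hx₀⟩ := DFunLike.ne_iff.1 hξ
    obtain ⟨a, ha⟩ := AddChar.ne_one_iff.1 (hψ hx₀)
    refine AddChar.sum_eq_zero_of_ne_one (ψ := ψ.compAddMonoidHom ξ.toAddMonoidHom)
      (AddChar.ne_one_iff.2 ⟨a • x₀, ?_⟩)
    simpa [mul_comm] using ha

variable {W : Type*} [AddCommGroup W] [Module F W]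
  {B : LinearMap.BilinForm F W} {R U : Submodule F W}

theorem gaussWeight_eq_card_mul [Fintype F] [DecidableEq F] [FiniteDimensional F W]
    (hF : ringChar F ≠ 2) (hψ : ψ.IsPrimitive) (hB : B.Nondegenerate)
    (hsymm : ∀ r ∈ R, ∀ w, B w r = B r w) (hdisj : Disjoint R U)
    (hsup : R ⊔ U = B.orthogonal R) :
    gaussWeight ψ B = Nat.card R * gaussWeight ψ (B.restrict U) := by
  obtain ⟨e, he, hBe⟩ := exists_hyperbolic_equiv hB hdisj hsup
  have e_left (r : R) : e ((0, r), 0) = r := by simpa using he r 0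
  have e_right (u : U) : e (0, u) = u := (he 0 u).trans (by simp)
  have apply_left (r : R) x : B (e ((0, r), 0)) (e x) = x.1.1 r := by rw [e_left, hBe]
  have apply_right (r : R) x : B (e x) (e ((0, r), 0)) = x.1.1 r := by
    rw [e_left, hsymm r r.2, hBe]
  have b := Module.finBasis F R
  have c := Module.finBasis F U
  let d := ((b.dualBasis.prod b).prod c).map e
  have toMatrix_eq : LinearMap.BilinForm.toMatrix d B =
      Matrix.fromBlocks (Matrix.fromBlocks
        (Matrix.of fun i j => B (e ((b.dualBasis i, 0), 0)) (e ((b.dualBasis j, 0), 0))) 1 1 0)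
        (Matrix.fromRows (Matrix.of fun i j => B (e ((b.dualBasis i, 0), 0)) (c j)) 0)
        (Matrix.fromCols (Matrix.of fun i j => B (c i) (e ((b.dualBasis j, 0), 0))) 0)
        (LinearMap.BilinForm.toMatrix c (B.restrict U)) := by
    ext ((i | i) | i) ((j | j) | j) <;>
    simp [d, LinearMap.BilinForm.toMatrix_apply, ← e_right, apply_left, apply_right,
      Finsupp.single_apply, Matrix.one_apply, eq_comm]
  have card_R : (Nat.card R : K) =
      quadraticChar F (-1) ^ Module.finrank F R *
        quadraticGaussSum ψ ^ (2 * Module.finrank F R) := by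
    rw [Module.natCard_eq_pow_finrank (K := F), Nat.card_eq_fintype_card, Nat.cast_pow,
      ← quadraticChar_neg_one_mul_quadraticGaussSum_sq hF hψ, mul_pow, pow_mul]
  rw [gaussWeight_eq ψ B d, toMatrix_eq, det_fromBlocks_hyperbolic, gaussWeight_eq ψ _ c, card_R]
  simp only [Fintype.card_sum, Fintype.card_fin, map_mul, map_pow, Int.cast_mul, Int.cast_pow]
  ring

theorem sum_smul_eq_card_smul [Fintype W] {E : Type*} [AddCommGroup E] [Module K E]
    (hF : ringChar F ≠ 2) (hψ : ψ.IsPrimitive)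
    (hB : B.Nondegenerate) (hsymm : ∀ r ∈ R, ∀ w, B w r = B r w) (hdisj : Disjoint R U)
    (hsup : R ⊔ U = B.orthogonal R) [Fintype U] {Φ : W → E} (hΦ : ∀ r ∈ R, ∀ w, Φ (w + r) = Φ w) :
    ∑ w, ψ (B w w) • Φ w = (Nat.card R : K) • ∑ u : U, ψ (B u u) • Φ u := by
  classical
  have : Fintype R := Fintype.ofFinite R
  obtain ⟨e, he, hBe⟩ := exists_hyperbolic_equiv hB hdisj hsup
  have : Fintype (Module.Dual F R) := Fintype.ofInjective (fun ξ => e ((ξ, 0), 0)) fun ξ η h => by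
    simpa using h
  have e_right (u : U) : e (0, u) = u := (he 0 u).trans (by simp)
  have e_add (ξ : Module.Dual F R) (r : R) (u : U) : e ((ξ, r), u) = e ((ξ, 0), u) + r := by
    rw [← show e ((0, r), 0) = r by simpa using he r 0, ← map_add]
    simp
  have R_isotropic (r : R) : B r r = 0 := by
    simpa [he] using hBe r ((0, r), 0)
  have apply_e (ξ : Module.Dual F R) (r : R) (u : U) :
      B (e ((ξ, r), u)) (e ((ξ, r), u)) = B (e ((ξ, 0), u)) (e ((ξ, 0), u)) + (2 • ξ) r := by
    rw [e_add]
    simp only [map_add, LinearMap.add_apply, hsymm r r.2, hBe, R_isotropic, LinearMap.smul_apply]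
    ring
  have Φ_e (ξ : Module.Dual F R) (r : R) (u : U) : Φ (e ((ξ, r), u)) = Φ (e ((ξ, 0), u)) := by
    rw [e_add, hΦ r r.2]
  have two_nsmul_eq_zero (ξ : Module.Dual F R) : 2 • ξ = 0 ↔ ξ = 0 := by
    rw [← Nat.cast_smul_eq_nsmul F]
    simp [Ring.two_ne_zero hF]
  calc ∑ w, ψ (B w w) • Φ w
      = ∑ u : U, ∑ ξ : Module.Dual F R, ∑ r : R,
          ψ ((2 • ξ) r) • ψ (B (e ((ξ, 0), u)) (e ((ξ, 0), u))) • Φ (e ((ξ, 0), u)) := by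
        rw [← e.toEquiv.sum_comp, Fintype.sum_prod_type_right]
        refine Finset.sum_congr rfl fun u _ => ?_
        rw [Fintype.sum_prod_type]
        refine Finset.sum_congr rfl fun ξ _ => Finset.sum_congr rfl fun r _ => ?_
        rw [LinearEquiv.coe_toEquiv, apply_e, Φ_e, AddChar.map_add_eq_mul, mul_comm, mul_smul]
    _ = ∑ u : U, (Nat.card R : K) • ψ (B u u) • Φ u := by
        refine Finset.sum_congr rfl fun u _ => ?_
        simp only [← Finset.sum_smul, sum_dual_apply hψ, two_nsmul_eq_zero, ite_smul, zero_smul,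
          Finset.sum_ite_eq', Finset.mem_univ, if_true]
        rw [Prod.mk_zero_zero, e_right]
    _ = (Nat.card R : K) • ∑ u : U, ψ (B u u) • Φ u := Finset.smul_sum.symm

end IsotropicReduction

section Reduction

section Field

variable {F W : Type*} [Field F] [AddCommGroup W] [Module F W]
  {B : LinearMap.BilinForm F W} {N M : Submodule F W}

theorem flip_orthogonal_of_symm (hsymm : ∀ x ∈ N, ∀ w, B w x = B x w) :
    B.flip.orthogonal N = B.orthogonal N := by
  ext w
  exact forall₂_congr fun x hx => by rw [LinearMap.BilinForm.flip_apply, hsymm x hx]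

variable [FiniteDimensional F W]

theorem orthogonal_inf_orthogonal (hB : B.Nondegenerate) (hsymm : ∀ x ∈ N, ∀ w, B w x = B x w) :
    B.orthogonal (N ⊓ B.orthogonal N) = N ⊔ B.orthogonal N := by
  have orthogonal_orthogonal : B.orthogonal (B.orthogonal N) = N := by
    rw [← flip_orthogonal_of_symm hsymm]
    exact flip_orthogonal_orthogonal hB.flip N
  have orthogonal_sup : B.orthogonal (N ⊔ B.orthogonal N) = N ⊓ B.orthogonal N := by
    refine le_antisymm (le_inf ?_ (LinearMap.BilinForm.orthogonal_le le_sup_left)) ?_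
    · exact (LinearMap.BilinForm.orthogonal_le le_sup_right).trans orthogonal_orthogonal.le
    · rintro w ⟨hw, hw'⟩ v hv
      obtain ⟨x, hx, y, hy, rfl⟩ := Submodule.mem_sup.1 hv
      rw [map_add, LinearMap.add_apply, hw' x hx, zero_add, hsymm w hw]
      exact hy w hw
  rw [← orthogonal_sup, ← flip_orthogonal_of_symm (N := B.orthogonal (N ⊔ B.orthogonal N))
    fun x hx => hsymm x (orthogonal_sup.le hx).1]
  exact flip_orthogonal_orthogonal hB _

theorem exists_adapted_complement (hB : B.Nondegenerate) (hsymm : ∀ x ∈ N, ∀ w, B w x = B x w)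
    (hdisj : Disjoint (N ⊓ B.orthogonal N) M)
    (hsup : (N ⊓ B.orthogonal N) ⊔ M = B.orthogonal N) :
    ∃ A, Disjoint (N ⊓ B.orthogonal N) A ∧ (N ⊓ B.orthogonal N) ⊔ A = N ∧ Disjoint A M ∧
      Disjoint (N ⊓ B.orthogonal N) (A ⊔ M) ∧
      (N ⊓ B.orthogonal N) ⊔ (A ⊔ M) = B.orthogonal (N ⊓ B.orthogonal N) := by
  obtain ⟨A, hRA, hRA_sup⟩ :=
    IsModularLattice.exists_disjoint_and_sup_eq (a := N ⊓ B.orthogonal N) inf_le_left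
  have hAN : A ≤ N := le_sup_right.trans hRA_sup.le
  have hMN : M ≤ B.orthogonal N := le_sup_right.trans hsup.le
  have hNM : Disjoint N M := by
    rw [disjoint_iff_inf_le]
    exact (le_inf (inf_le_inf_left N hMN) inf_le_right).trans hdisj.le_bot
  refine ⟨A, hRA, hRA_sup, hNM.mono_left hAN, ?_, ?_⟩
  · exact hRA.disjoint_sup_right_of_disjoint_sup_left (hRA_sup.symm ▸ hNM)
  · calc (N ⊓ B.orthogonal N) ⊔ (A ⊔ M)
        = N ⊔ (N ⊓ B.orthogonal N ⊔ M) := by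
          rw [← sup_assoc, hRA_sup, ← sup_assoc, sup_inf_self]
      _ = B.orthogonal (N ⊓ B.orthogonal N) := by
          rw [hsup, orthogonal_inf_orthogonal hB hsymm]

theorem restrict_nondegenerate_of_disjoint_radical {A : Submodule F W}
    (hsymm : ∀ x ∈ N, ∀ w, B w x = B x w) (hdisj : Disjoint (N ⊓ B.orthogonal N) A)
    (hsup : (N ⊓ B.orthogonal N) ⊔ A = N) : (B.restrict A).Nondegenerate := by
  have hAN : A ≤ N := le_sup_right.trans hsup.le
  refine LinearMap.BilinForm.Nondegenerate.ofSeparatingLeft fun a ha => ?_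
  refine Subtype.ext (Submodule.disjoint_def.1 hdisj a ⟨hAN a.2, fun x hx => ?_⟩ a.2)
  rw [← hsup] at hx
  obtain ⟨r, hr, b, hb, rfl⟩ := Submodule.mem_sup.1 hx
  rw [← hsymm _ (hsup ▸ hx), map_add, ← ha ⟨b, hb⟩,
    show B a r = 0 from hr.2 a (hAN a.2), zero_add]
  rfl

end Field

variable {F K W : Type*} [Field F] [Field K] {ψ : AddChar F K} [AddCommGroup W] [Module F W]
  {B : LinearMap.BilinForm F W} {N M : Submodule F W} [Fintype N]

theorem sum_apply_self_sup {R A : Submodule F W} [Fintype A] (hdisj : Disjoint R A)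
    (hsup : R ⊔ A = N) (hR : ∀ r ∈ R, ∀ x ∈ N, B r x = 0 ∧ B x r = 0) :
    ∑ x : N, ψ (B x x) = Nat.card R * ∑ a : A, ψ (B a a) := by
  subst hsup
  have : Fintype R := Fintype.ofInjective _ (Submodule.inclusion_injective (le_sup_left (b := A)))
  have apply_add (r : R) (a : A) : B (r + a) (r + a) = B a a := by
    have hr := hR r r.2 r (Submodule.mem_sup_left r.2)
    have ha := hR r r.2 a (Submodule.mem_sup_right a.2)
    simp only [map_add, LinearMap.add_apply, hr, ha, zero_add]
  rw [sum_sup hdisj fun w => ψ (B w w)]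
  simp only [apply_add, Finset.sum_const, Finset.card_univ, nsmul_eq_mul, Nat.card_eq_fintype_card]

theorem sum_apply_self_mul_gaussWeight [Fintype F] [DecidableEq F] [FiniteDimensional F W]
    (hF : ringChar F ≠ 2) (hψ : ψ.IsPrimitive)
    (hB : B.Nondegenerate) (hsymm : ∀ x ∈ N, ∀ w, B w x = B x w)
    (hdisj : Disjoint (N ⊓ B.orthogonal N) M)
    (hsup : (N ⊓ B.orthogonal N) ⊔ M = B.orthogonal N) :
    (∑ x : N, ψ (B x x)) * gaussWeight ψ (B.restrict M) = gaussWeight ψ B := by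
  obtain ⟨A, hRA, hRA_sup, hAM, hRAM, hRAM_sup⟩ := exists_adapted_complement hB hsymm hdisj hsup
  have : Fintype A := @Fintype.ofFinite _ (Module.finite_of_finite F)
  have hRN : N ⊓ B.orthogonal N ≤ N := inf_le_left
  have hAN : A ≤ N := le_sup_right.trans hRA_sup.le
  have hMN : M ≤ B.orthogonal N := le_sup_right.trans hsup.le
  have sum_A : ∑ a : A, ψ (B a a) = gaussWeight ψ (B.restrict A) :=
    sum_apply_self_eq_gaussWeight (B := B.restrict A) hF hψ
      (restrict_nondegenerate_of_disjoint_radical hsymm hRA hRA_sup)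
      ⟨fun a b => hsymm b (hAN b.2) a⟩
  calc (∑ x : N, ψ (B x x)) * gaussWeight ψ (B.restrict M)
      = Nat.card ↥(N ⊓ B.orthogonal N) *
          (gaussWeight ψ (B.restrict A) * gaussWeight ψ (B.restrict M)) := by
        rw [sum_apply_self_sup hRA hRA_sup fun r hr x hx =>
          ⟨(hsymm r hr.1 x).symm.trans (hr.2 x hx), hr.2 x hx⟩, sum_A, mul_assoc]
    _ = Nat.card ↥(N ⊓ B.orthogonal N) * gaussWeight ψ (B.restrict (A ⊔ M)) := by
        rw [gaussWeight_restrict_sup hAM fun a ha m hm =>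
          (hsymm a (hAN ha) m).trans (hMN hm a (hAN ha))]
    _ = gaussWeight ψ B :=
        (gaussWeight_eq_card_mul hF hψ hB (fun r hr => hsymm r (hRN hr)) hRAM hRAM_sup).symm

theorem sum_smul_eq_sum_apply_self_smul [Fintype W] [Fintype M] {E : Type*} [AddCommGroup E]
    [Module K E] (hF : ringChar F ≠ 2) (hψ : ψ.IsPrimitive)
    (hB : B.Nondegenerate) (hsymm : ∀ x ∈ N, ∀ w, B w x = B x w)
    (hdisj : Disjoint (N ⊓ B.orthogonal N) M)
    (hsup : (N ⊓ B.orthogonal N) ⊔ M = B.orthogonal N)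
    {Φ : W → E} (hΦ : ∀ x ∈ N, ∀ w, Φ (w + x) = Φ w) :
    ∑ w, ψ (B w w) • Φ w = (∑ x : N, ψ (B x x)) • ∑ m : M, ψ (B m m) • Φ m := by
  obtain ⟨A, hRA, hRA_sup, hAM, hRAM, hRAM_sup⟩ := exists_adapted_complement hB hsymm hdisj hsup
  have : Fintype A := Fintype.ofFinite A
  have : Fintype ↥(A ⊔ M) := Fintype.ofFinite _
  have hRN : N ⊓ B.orthogonal N ≤ N := inf_le_left
  have hAN : A ≤ N := le_sup_right.trans hRA_sup.le
  have hMN : M ≤ B.orthogonal N := le_sup_right.trans hsup.le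
  have apply_add (a : A) (m : M) : B (a + m) (a + m) = B a a + B m m := by
    have h : B a m = 0 := hMN m.2 a (hAN a.2)
    simp [h, hsymm a (hAN a.2) m]
  have Φ_add (a : A) (m : M) : Φ (a + m) = Φ m := by rw [add_comm, hΦ a (hAN a.2)]
  calc ∑ w, ψ (B w w) • Φ w
      = (Nat.card ↥(N ⊓ B.orthogonal N) : K) •
          ∑ w : ↥(A ⊔ M), ψ (B w w) • Φ w :=
        sum_smul_eq_card_smul hF hψ hB (fun r hr => hsymm r (hRN hr)) hRAM hRAM_sup
          fun r hr => hΦ r (hRN hr)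
    _ = (Nat.card ↥(N ⊓ B.orthogonal N) * ∑ a : A, ψ (B a a)) •
          ∑ m : M, ψ (B m m) • Φ m := by
        rw [sum_sup hAM fun w => ψ (B w w) • Φ w, mul_smul, Finset.sum_smul]
        simp only [apply_add, Φ_add, AddChar.map_add_eq_mul, mul_smul, Finset.smul_sum]
    _ = (∑ x : N, ψ (B x x)) • ∑ m : M, ψ (B m m) • Φ m := by
        rw [sum_apply_self_sup hRA hRA_sup fun r hr x hx =>
          ⟨(hsymm r hr.1 x).symm.trans (hr.2 x hx), hr.2 x hx⟩]

end Reduction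

section Pushforward

variable {F W X : Type*} [Field F] [AddCommGroup W] [Module F W] [AddCommGroup X] [Module F X]
  {B : LinearMap.BilinForm F W} {S : W →ₗ[F] X} {J : Submodule F X} {G : LinearMap.BilinForm F J}

theorem exists_complement_equiv (hJ : (B.orthogonal S.ker).map S = J)
    (hG : ∀ v ∈ B.orthogonal S.ker, ∀ w ∈ B.orthogonal S.ker, ∀ x y : J,
      S v = x → S w = y → G x y = B v w) :
    ∃ M, Disjoint (S.ker ⊓ B.orthogonal S.ker) M ∧
      (S.ker ⊓ B.orthogonal S.ker) ⊔ M = B.orthogonal S.ker ∧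
      ∃ e : M ≃ₗ[F] J, (∀ m, (e m : X) = S m) ∧ ∀ m m', G (e m) (e m') = B.restrict M m m' := by
  obtain ⟨M, hdisj, hsup⟩ := IsModularLattice.exists_disjoint_and_sup_eq
    (a := S.ker ⊓ B.orthogonal S.ker) (b := B.orthogonal S.ker) inf_le_right
  have hM : M ≤ B.orthogonal S.ker := le_sup_right.trans hsup.le
  have injective : Function.Injective (S.domRestrict M) := by
    refine (injective_iff_map_eq_zero _).2 fun m hm => Subtype.ext ?_
    exact Submodule.disjoint_def.1 hdisj m ⟨hm, hM m.2⟩ m.2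
  have range_eq : (S.domRestrict M).range = J := by
    have map_radical : (S.ker ⊓ B.orthogonal S.ker).map S = ⊥ :=
      LinearMap.le_ker_iff_map.1 inf_le_left
    rw [LinearMap.range_domRestrict, ← hJ, ← hsup, Submodule.map_sup, map_radical, bot_sup_eq]
  let e := (LinearEquiv.ofInjective _ injective).trans (LinearEquiv.ofEq _ _ range_eq)
  exact ⟨M, hdisj, hsup, e, fun m => rfl, fun m m' => hG m (hM m.2) m' (hM m'.2) _ _ rfl rfl⟩

variable {K : Type*} [Field K] [Fintype S.ker] {ψ : AddChar F K}

theorem sum_ker_mul_gaussWeight [Fintype F] [DecidableEq F] [FiniteDimensional F W]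
    [FiniteDimensional F J]
    (hF : ringChar F ≠ 2) (hψ : ψ.IsPrimitive) (hB : B.Nondegenerate)
    (hsymm : ∀ x ∈ S.ker, ∀ w, B w x = B x w) (hJ : (B.orthogonal S.ker).map S = J)
    (hG : ∀ v ∈ B.orthogonal S.ker, ∀ w ∈ B.orthogonal S.ker, ∀ x y : J,
      S v = x → S w = y → G x y = B v w) :
    (∑ x : S.ker, ψ (B x x)) * gaussWeight ψ G = gaussWeight ψ B := by
  obtain ⟨M, hdisj, hsup, e, -, hGe⟩ := exists_complement_equiv hJ hG
  rw [gaussWeight_congr e hGe, sum_apply_self_mul_gaussWeight hF hψ hB hsymm hdisj hsup]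

theorem sum_smul_comp_eq_sum_ker_smul [Fintype W] [Fintype J] {E : Type*} [AddCommGroup E]
    [Module K E]
    (hF : ringChar F ≠ 2) (hψ : ψ.IsPrimitive) (hB : B.Nondegenerate)
    (hsymm : ∀ x ∈ S.ker, ∀ w, B w x = B x w) (hJ : (B.orthogonal S.ker).map S = J)
    (hG : ∀ v ∈ B.orthogonal S.ker, ∀ w ∈ B.orthogonal S.ker, ∀ x y : J,
      S v = x → S w = y → G x y = B v w) (Φ : X → E) :
    ∑ w, ψ (B w w) • Φ (S w) = (∑ x : S.ker, ψ (B x x)) • ∑ y : J, ψ (G y y) • Φ y := by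
  obtain ⟨M, hdisj, hsup, e, he, hGe⟩ := exists_complement_equiv hJ hG
  have : Fintype M := Fintype.ofFinite M
  have S_add : ∀ x ∈ S.ker, ∀ w, Φ (S (w + x)) = Φ (S w) := fun x hx w => by
    rw [map_add, LinearMap.mem_ker.1 hx, add_zero]
  rw [sum_smul_eq_sum_apply_self_smul hF hψ hB hsymm hdisj hsup S_add, ← e.toEquiv.sum_comp]
  simp only [LinearEquiv.coe_toEquiv, hGe, he]
  rfl

end Pushforward

section Isometry

variable {p : ℕ} {V : Type*} [AddCommGroup V] [Module (ZMod p) V]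
  {f : LinearMap.BilinForm (ZMod p) V}

@[simp] theorem act_inv_act (g : isometryGroup f) (x : V) : act g⁻¹ (act g x) = x := by
  rw [← act_mul, mul_inv_cancel]
  rfl

@[simp] theorem act_act_inv (g : isometryGroup f) (x : V) : act g (act g⁻¹ x) = x := by
  simpa using act_inv_act g⁻¹ x

theorem image_inv (g : isometryGroup f) : image g⁻¹ = image g := by
  ext x
  constructor
  · rintro ⟨u, rfl⟩
    exact ⟨-act g⁻¹ u, by simp [sub_eq_add_neg, add_comm]⟩
  · rintro ⟨u, rfl⟩
    exact ⟨-act g u, by simp [sub_eq_add_neg, add_comm]⟩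

theorem wallForm_sub_swap (hf : f.IsAlt) (g : isometryGroup f) (x y : image g) :
    wallForm g x y - wallForm g y x = f x y := by
  obtain ⟨_, u, rfl⟩ := x
  obtain ⟨_, v, rfl⟩ := y
  rw [wallForm_apply g u _ _ rfl, wallForm_apply g v _ _ rfl]
  simp only [LinearMap.sub_apply, LinearMap.id_apply, map_sub, act_preserves]
  rw [← hf.neg_eq u v, ← hf.neg_eq (act g u) v]
  ring

theorem wallForm_inv (hf : f.IsAlt) (g : isometryGroup f) {x y : V} (hx : x ∈ image g)
    (hy : y ∈ image g) (hx' : x ∈ image g⁻¹) (hy' : y ∈ image g⁻¹) :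
    wallForm g⁻¹ ⟨x, hx'⟩ ⟨y, hy'⟩ = -wallForm g ⟨y, hy⟩ ⟨x, hx⟩ := by
  have hswap := wallForm_sub_swap hf g ⟨x, hx⟩ ⟨y, hy⟩
  obtain ⟨u, rfl⟩ := id hx
  rw [wallForm_apply g u ⟨_, hx⟩ _ rfl] at hswap
  rw [wallForm_apply g⁻¹ (-act g u) _ _ (by simp [sub_eq_add_neg, add_comm])]
  simp only [LinearMap.sub_apply, LinearMap.id_apply, map_sub, map_neg, LinearMap.neg_apply]
    at hswap ⊢
  linear_combination -hswap

theorem act_eq_self_of_orthogonal_image (hf : f.Nondegenerate) {g : isometryGroup f} {u : V}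
    (hu : ∀ x ∈ image g, f u x = 0) : act g u = u := by
  refine sub_eq_zero.1 (hf.1 _ fun w => ?_)
  have hw := hu _ ⟨act g⁻¹ w, rfl⟩
  have hg := act_preserves g u (act g⁻¹ w)
  simp only [LinearMap.sub_apply, LinearMap.id_apply, act_act_inv, map_sub] at hw hg ⊢
  rw [hg, hw]

theorem wallForm_separatingLeft (hf : f.Nondegenerate) (g : isometryGroup f) :
    (wallForm g).SeparatingLeft := by
  rintro ⟨_, u, rfl⟩ hu
  have act_u : act g u = u := act_eq_self_of_orthogonal_image hf fun x hx => by
    rw [← hu ⟨x, hx⟩, wallForm_apply g u _ ⟨x, hx⟩ rfl]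
  ext
  simp [act_u]

end Isometry

section Pair

variable {p : ℕ} {V : Type*} [AddCommGroup V] [Module (ZMod p) V]
  {f : LinearMap.BilinForm (ZMod p) V} (g h : isometryGroup f)

/-- The bilinear form on `I(g) × I(h)` whose quadratic form is the exponent in the product
`s(g) s(h)`: the Wall forms contribute the diagonal terms and `f` the commutation factor of
`ρ(x, 0) ρ(y, 0)`. -/
noncomputable def pairForm : LinearMap.BilinForm (ZMod p) (image g × image h) :=
  (wallForm g).compl₁₂ (LinearMap.fst _ _ _) (LinearMap.fst _ _ _) +
    (wallForm h).compl₁₂ (LinearMap.snd _ _ _) (LinearMap.snd _ _ _) +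
    f.compl₁₂ ((image g).subtype.comp (LinearMap.fst _ _ _))
      ((image h).subtype.comp (LinearMap.snd _ _ _))

variable {g h}

theorem pairForm_apply (a b : image g × image h) :
    pairForm g h a b = wallForm g a.1 b.1 + wallForm h a.2 b.2 + f a.1 b.2 := rfl

variable (g h) in
/-- The addition map `I(g) × I(h) → V`. -/
noncomputable def pairSum : image g × image h →ₗ[ZMod p] V :=
  (image g).subtype.coprod (image h).subtype

theorem pairSum_apply (a : image g × image h) : pairSum g h a = a.1 + a.2 := rfl

theorem mem_ker_pairSum {a : image g × image h} :
    a ∈ (pairSum g h).ker ↔ (a.1 : V) + a.2 = 0 := Iff.rfl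

theorem pairForm_sub_swap (hf : f.IsAlt) (a b : image g × image h) :
    pairForm g h a b - pairForm g h b a = f (pairSum g h a) (pairSum g h b) := by
  have swap_g := wallForm_sub_swap hf g a.1 b.1
  have swap_h := wallForm_sub_swap hf h a.2 b.2
  have swap_f := hf.neg_eq (a.2 : V) b.1
  simp only [pairForm_apply, pairSum_apply, map_add, LinearMap.add_apply]
  linear_combination swap_g + swap_h + swap_f

theorem pairForm_symm_of_mem_ker (hf : f.IsAlt) {a : image g × image h}
    (ha : a ∈ (pairSum g h).ker) (b : image g × image h) :
    pairForm g h b a = pairForm g h a b := by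
  rw [← sub_eq_zero, pairForm_sub_swap hf, LinearMap.mem_ker.1 ha, map_zero]

/-- The identification of `I(g) ∩ I(h⁻¹)` with the kernel of the addition map on `I(g) × I(h)`
as the antidiagonal. -/
def antidiagEquiv : ↥(image g ⊓ image h⁻¹) ≃ (pairSum g h).ker where
  toFun x := ⟨(⟨x, x.2.1⟩, -⟨x, (image_inv h).le x.2.2⟩),
    mem_ker_pairSum.2 (add_neg_cancel (x : V))⟩
  invFun a := ⟨a.1.1, a.1.1.2, (image_inv h).ge <| by
    rw [eq_neg_of_add_eq_zero_left (mem_ker_pairSum.1 a.2)]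
    exact neg_mem a.1.2.2⟩
  left_inv _ := rfl
  right_inv a := Subtype.ext <| Prod.ext rfl <| Subtype.ext
    (eq_neg_of_add_eq_zero_right (mem_ker_pairSum.1 a.2)).symm

theorem pairForm_antidiagEquiv (hf : f.IsAlt) (x : ↥(image g ⊓ image h⁻¹)) :
    pairForm g h (antidiagEquiv x) (antidiagEquiv x) = gammaForm g h x x := by
  have hx : (x : V) ∈ image h := (image_inv h).le x.2.2
  rw [gammaForm, wallForm_inv hf h hx hx, pairForm_apply]
  simp [antidiagEquiv, hf.self_eq_zero]

theorem pairForm_separatingLeft (hf : f.Nondegenerate) : (pairForm g h).SeparatingLeft := by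
  intro a ha
  have fst_eq_zero : a.1 = 0 := wallForm_separatingLeft hf g a.1 fun x => by
    simpa [pairForm_apply] using ha (x, 0)
  have snd_eq_zero : a.2 = 0 := wallForm_separatingLeft hf h a.2 fun x => by
    simpa [pairForm_apply, fst_eq_zero] using ha (0, x)
  exact Prod.ext fst_eq_zero snd_eq_zero

variable (g h) in
/-- The map `u ↦ (u(1 - g), ug(1 - h))`, which turns `u(1 - gh)` into a sum of elements of `I(g)`
and `I(h)`. -/
noncomputable def telescope : V →ₗ[ZMod p] image g × image h :=
  (LinearMap.id - act g).rangeRestrict.prod ((LinearMap.id - act h).rangeRestrict.comp (act g))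

theorem pairSum_telescope (u : V) : pairSum g h (telescope g h u) = u - act (g * h) u :=
  sub_add_sub_cancel u (act g u) (act h (act g u))

theorem pairForm_telescope (u : V) (a : image g × image h) :
    pairForm g h (telescope g h u) a = f u (pairSum g h a) := by
  have apply_g : wallForm g (telescope g h u).1 a.1 = f u a.1 := wallForm_apply g u _ _ rfl
  have apply_h : wallForm h (telescope g h u).2 a.2 = f (act g u) a.2 :=
    wallForm_apply h (act g u) _ _ rfl
  have telescope_fst : ((telescope g h u).1 : V) = u - act g u := rfl
  rw [pairForm_apply, apply_g, apply_h, telescope_fst, pairSum_apply]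
  simp

theorem orthogonal_range_telescope (hf : f.Nondegenerate) :
    (pairForm g h).orthogonal (telescope g h).range = (pairSum g h).ker := by
  ext a
  rw [LinearMap.mem_ker, LinearMap.BilinForm.mem_orthogonal_iff]
  constructor
  · exact fun ha => hf.2 _ fun u => (pairForm_telescope u a).symm.trans (ha _ ⟨u, rfl⟩)
  · rintro ha _ ⟨u, rfl⟩
    exact (pairForm_telescope u a).trans (by rw [ha, map_zero])

variable [Fact p.Prime] [Finite V]

theorem wallForm_nondegenerate (hf : f.Nondegenerate) (g : isometryGroup f) :
    (wallForm g).Nondegenerate :=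
  LinearMap.BilinForm.Nondegenerate.ofSeparatingLeft (wallForm_separatingLeft hf g)

theorem pairForm_nondegenerate (hf : f.Nondegenerate) : (pairForm g h).Nondegenerate :=
  LinearMap.BilinForm.Nondegenerate.ofSeparatingLeft (pairForm_separatingLeft hf)

theorem orthogonal_ker_pairSum (hf : f.Nondegenerate) (hfa : f.IsAlt) :
    (pairForm g h).orthogonal (pairSum g h).ker = (telescope g h).range := by
  rw [← flip_orthogonal_of_symm fun a ha b => pairForm_symm_of_mem_ker hfa ha b,
    ← orthogonal_range_telescope hf]
  exact flip_orthogonal_orthogonal (pairForm_nondegenerate hf) _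

theorem map_pairSum_orthogonal_ker (hf : f.Nondegenerate) (hfa : f.IsAlt) :
    ((pairForm g h).orthogonal (pairSum g h).ker).map (pairSum g h) = image (g * h) := by
  rw [orthogonal_ker_pairSum hf hfa, ← LinearMap.range_comp]
  exact congrArg LinearMap.range (LinearMap.ext pairSum_telescope)

theorem wallForm_mul_apply (hf : f.Nondegenerate) (hfa : f.IsAlt) :
    ∀ a ∈ (pairForm g h).orthogonal (pairSum g h).ker,
      ∀ b ∈ (pairForm g h).orthogonal (pairSum g h).ker, ∀ x y : image (g * h),
        pairSum g h a = x → pairSum g h b = y → wallForm (g * h) x y = pairForm g h a b := by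
  rw [orthogonal_ker_pairSum hf hfa]
  rintro _ ⟨u, rfl⟩ b - x y hx hy
  rw [pairForm_telescope, hy, wallForm_apply (g * h) u x y (hx.symm.trans (pairSum_telescope u))]

end Pair

section Splitting

variable {p : ℕ} [Fact p.Prime] {K : Type*} [Field K] {ε : K}

theorem ringChar_zmod_ne_two (hp : Odd p) : ringChar (ZMod p) ≠ 2 := by
  rw [ZMod.ringChar_zmod_n]
  rintro rfl
  exact absurd hp (by decide)

theorem natCast_card_ne_zero (hε : IsPrimitiveRoot ε p) (V : Type*) [AddCommGroup V]
    [Module (ZMod p) V] [Finite V] : (Nat.card V : K) ≠ 0 := by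
  have : NeZero p := ⟨(Fact.out : p.Prime).ne_zero⟩
  rw [Module.natCard_eq_pow_finrank (K := ZMod p), Nat.card_zmod, Nat.cast_pow]
  exact pow_ne_zero _ hε.neZero'.out

theorem zmodChar_eq_expo (h : ε ^ p = 1) (t : ZMod p) : AddChar.zmodChar p h t = expo ε t :=
  AddChar.zmodChar_apply h t

variable {V : Type*} [AddCommGroup V] [Module (ZMod p) V] {f : LinearMap.BilinForm (ZMod p) V}
  {g h : isometryGroup f}

theorem sum_ker_pairForm (hε : ε ^ p = 1) (hfa : f.IsAlt) [Fintype (pairSum g h).ker] :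
    ∑ a : (pairSum g h).ker, AddChar.zmodChar p hε (pairForm g h a a) =
      ∑ᶠ x : ↥(image g ⊓ image h⁻¹), expo ε (gammaForm g h x x) := by
  rw [← finsum_eq_sum_of_fintype]
  refine (finsum_eq_of_bijective antidiagEquiv antidiagEquiv.bijective fun x => ?_).symm
  rw [zmodChar_eq_expo, pairForm_antidiagEquiv hfa]

variable [Finite V]

theorem splitting_eq (hε : ε ^ p = 1) (g : isometryGroup f) :
    splitting ε g =
      (Nat.card (image g) : K)⁻¹ * gaussWeight (AddChar.zmodChar p hε) (wallForm g) := by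
  have gaussSum_eq : gaussSum p ε = quadraticGaussSum (AddChar.zmodChar p hε) := by
    simp only [gaussSum, quadraticGaussSum, zmodChar_eq_expo]
  rw [splitting, gaussSum_eq, mul_assoc]
  rfl

theorem splitting_ne_zero (hp : Odd p) (hf : f.Nondegenerate) (hε : IsPrimitiveRoot ε p)
    (g : isometryGroup f) : splitting ε g ≠ 0 := by
  have : NeZero p := ⟨(Fact.out : p.Prime).ne_zero⟩
  rw [splitting_eq hε.pow_eq_one]
  refine mul_ne_zero (inv_ne_zero (natCast_card_ne_zero hε _))
    (gaussWeight_ne_zero (ringChar_zmod_ne_two hp)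
      (AddChar.zmodChar_primitive_of_primitive_root p hε) ?_ (wallForm_nondegenerate hf g))
  rw [ZMod.card]
  exact hε.neZero'.out

theorem finsum_gammaForm_mul_gaussWeight (hp : Odd p) (hf : f.Nondegenerate) (hfa : f.IsAlt)
    (hε : IsPrimitiveRoot ε p) (g h : isometryGroup f) :
    (∑ᶠ x : ↥(image g ⊓ image h⁻¹), expo ε (gammaForm g h x x)) *
        gaussWeight (AddChar.zmodChar p hε.pow_eq_one) (wallForm (g * h)) =
      gaussWeight (AddChar.zmodChar p hε.pow_eq_one) (wallForm g) *
        gaussWeight (AddChar.zmodChar p hε.pow_eq_one) (wallForm h) := by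
  have : Fintype (image g × image h) := Fintype.ofFinite _
  have : Fintype (pairSum g h).ker := Fintype.ofFinite _
  rw [← sum_ker_pairForm hε.pow_eq_one hfa,
    sum_ker_mul_gaussWeight (ringChar_zmod_ne_two hp)
      (AddChar.zmodChar_primitive_of_primitive_root p hε) (pairForm_nondegenerate hf)
      (fun a ha b => pairForm_symm_of_mem_ker hfa ha b) (map_pairSum_orthogonal_ker hf hfa)
      (wallForm_mul_apply hf hfa)]
  exact gaussWeight_prod (by simp [pairForm_apply]) (by simp [pairForm_apply])
    (by simp [pairForm_apply])

theorem factorSet_eq (hp : Odd p) (hf : f.Nondegenerate) (hfa : f.IsAlt)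
    (hε : IsPrimitiveRoot ε p) (g h : isometryGroup f) :
    factorSet ε g h = splitting ε g * splitting ε h * (splitting ε (g * h))⁻¹ := by
  have card_ne_zero := natCast_card_ne_zero hε (image (g * h))
  rw [eq_mul_inv_iff_mul_eq₀ (splitting_ne_zero hp hf hε _), factorSet]
  simp only [splitting_eq hε.pow_eq_one]
  rw [mul_mul_mul_comm (Nat.card (image g) : K)⁻¹, ← finsum_gammaForm_mul_gaussWeight hp hf hfa hε]
  field_simp

theorem splitting_eq_map_inv (hp : Odd p) (hfa : f.IsAlt) (hε : IsPrimitiveRoot ε p)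
    (η : K →+* K) (hη : η ε = ε⁻¹) (g : isometryGroup f) :
    splitting ε g = η (splitting ε g⁻¹) := by
  have map_char : (η : K →* K).compAddChar (AddChar.zmodChar p hε.pow_eq_one) =
      (AddChar.zmodChar p hε.pow_eq_one)⁻¹ := by
    ext t
    rw [MonoidHom.coe_compAddChar, Function.comp_apply, AddChar.inv_apply',
      zmodChar_eq_expo, expo, MonoidHom.coe_coe, map_pow, hη, inv_pow]
  have weight_inv : gaussWeight (AddChar.zmodChar p hε.pow_eq_one) (wallForm g⁻¹) =
      gaussWeight (AddChar.zmodChar p hε.pow_eq_one) (-(wallForm g).flip) :=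
    gaussWeight_congr (LinearEquiv.ofEq _ _ (image_inv g).symm) fun x y =>
      wallForm_inv hfa g x.2 y.2 _ _
  rw [splitting_eq hε.pow_eq_one, splitting_eq hε.pow_eq_one, weight_inv, map_mul, map_inv₀,
    map_natCast, map_gaussWeight, map_char, image_inv,
    gaussWeight_inv_neg_flip (ringChar_zmod_ne_two hp)
      (AddChar.zmodChar_primitive_of_primitive_root p hε)]

end Splitting

section WeilOperators

theorem card_nsmul_sum_comp {A B E : Type*} [AddGroup A] [AddGroup B] [Fintype A] [Fintype B]
    [AddCommMonoid E] {T : A →+ B} (hT : Function.Surjective T) (H : B → E) :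
    Fintype.card B • ∑ a, H (T a) = Fintype.card A • ∑ b, H b := by
  have sum_translate (b : B) : ∑ a, H (T a) = ∑ a, H (T a + b) := by
    obtain ⟨c, rfl⟩ := hT b
    refine Fintype.sum_equiv (Equiv.subRight c) _ _ fun a => ?_
    rw [Equiv.subRight_apply, ← map_add, sub_add_cancel]
  calc Fintype.card B • ∑ a, H (T a)
      = ∑ b, ∑ a, H (T a + b) := by
        simp only [← sum_translate, Finset.sum_const, Finset.card_univ]
    _ = ∑ a, ∑ b, H (T a + b) := Finset.sum_comm
    _ = Fintype.card A • ∑ b, H b := by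
        have sum_shift (a : A) : ∑ b, H (T a + b) = ∑ b, H b :=
          Fintype.sum_equiv (Equiv.addLeft (T a)) _ _ fun _ => rfl
        simp only [sum_shift, Finset.sum_const, Finset.card_univ]

variable {p : ℕ} [Fact p.Prime] {V : Type*} [AddCommGroup V] [Module (ZMod p) V]
  {f : LinearMap.BilinForm (ZMod p) V}
  {K V' : Type*} [Field K] [AddCommGroup V'] [Module K V']
  {ρ : Representation K (Extraspecial f) V'} {ε : K}

theorem representation_apply_eq_smul
    (hρε : ∀ z : ZMod p, ρ ⟨0, z⟩ = expo ε z • (1 : Module.End K V')) (a : Extraspecial f) :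
    ρ a = expo ε a.cen • ρ ⟨a.vec, 0⟩ := by
  rw [← smul_one_mul, ← hρε, ← map_mul]
  congr 1
  ext <;> simp

theorem representation_mul_vec
    (hρε : ∀ z : ZMod p, ρ ⟨0, z⟩ = expo ε z • (1 : Module.End K V')) (x y : V) :
    ρ ⟨x, 0⟩ * ρ ⟨y, 0⟩ = expo ε (f x y) • ρ ⟨x + y, 0⟩ := by
  rw [← map_mul, representation_apply_eq_smul hρε]
  simp

theorem representation_mul_act_inv (hfa : f.IsAlt)
    (hρε : ∀ z : ZMod p, ρ ⟨0, z⟩ = expo ε z • (1 : Module.End K V')) (g : isometryGroup f)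
    {u : V} {x : image g} (hu : u - act g u = x) :
    ρ ⟨u, 0⟩ * ρ (⟨act g u, 0⟩ : Extraspecial f)⁻¹ =
      expo ε (wallForm g x x) • ρ ⟨(x : V), 0⟩ := by
  rw [← map_mul, representation_apply_eq_smul hρε, wallForm_apply g u x x hu.symm]
  simp [← hu, hfa.self_eq_zero, sub_eq_add_neg]

variable [Fintype V]

theorem weilOp_eq_sum (hfa : f.IsAlt) (hε : IsPrimitiveRoot ε p)
    (hρε : ∀ z : ZMod p, ρ ⟨0, z⟩ = expo ε z • (1 : Module.End K V')) (g : isometryGroup f)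
    [Fintype (image g)] :
    weilOp ρ g = (Nat.card (image g) : K)⁻¹ •
      ∑ x : image g, expo ε (wallForm g x x) • ρ ⟨(x : V), 0⟩ := by
  have card_image : (Nat.card (image g) : K) ≠ 0 := natCast_card_ne_zero hε _
  have card_V : (Fintype.card V : K) ≠ 0 :=
    Nat.card_eq_fintype_card (α := V) ▸ natCast_card_ne_zero hε V
  have sum_eq := card_nsmul_sum_comp
    (T := (LinearMap.id - act g).rangeRestrict.toAddMonoidHom)
    (LinearMap.surjective_rangeRestrict _)
    fun x : image g => expo ε (wallForm g x x) • ρ ⟨(x : V), 0⟩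
  rw [← Nat.cast_smul_eq_nsmul K, ← Nat.cast_smul_eq_nsmul K, ← Nat.card_eq_fintype_card] at sum_eq
  rw [weilOp, inv_smul_eq_iff₀ card_V, smul_comm, eq_inv_smul_iff₀ card_image, ← sum_eq]
  congr 1
  exact Finset.sum_congr rfl fun u _ => representation_mul_act_inv hfa hρε g rfl

theorem weilOp_mul_weilOp (hp : Odd p) (hf : f.Nondegenerate) (hfa : f.IsAlt)
    (hε : IsPrimitiveRoot ε p)
    (hρε : ∀ z : ZMod p, ρ ⟨0, z⟩ = expo ε z • (1 : Module.End K V')) (g h : isometryGroup f) :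
    weilOp ρ g * weilOp ρ h = factorSet ε g h • weilOp ρ (g * h) := by
  have (k : isometryGroup f) : Fintype (image k) := Fintype.ofFinite _
  have : Fintype (pairSum g h).ker := Fintype.ofFinite _
  have expo_add (s t : ZMod p) : expo ε (s + t) = expo ε s * expo ε t := by
    simp only [← zmodChar_eq_expo hε.pow_eq_one, AddChar.map_add_eq_mul]
  have sum_mul_sum : (∑ x : image g, expo ε (wallForm g x x) • ρ ⟨(x : V), 0⟩) *
      ∑ y : image h, expo ε (wallForm h y y) • ρ ⟨(y : V), 0⟩ =
        (∑ᶠ x : ↥(image g ⊓ image h⁻¹), expo ε (gammaForm g h x x)) •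
          ∑ z : image (g * h), expo ε (wallForm (g * h) z z) • ρ ⟨(z : V), 0⟩ := by
    have reduction := sum_smul_comp_eq_sum_ker_smul (B := pairForm g h) (S := pairSum g h)
      (G := wallForm (g * h)) (ringChar_zmod_ne_two hp)
      (AddChar.zmodChar_primitive_of_primitive_root p hε) (pairForm_nondegenerate hf)
      (fun a ha b => pairForm_symm_of_mem_ker hfa ha b) (map_pairSum_orthogonal_ker hf hfa)
      (wallForm_mul_apply hf hfa) fun x => ρ ⟨x, 0⟩
    rw [sum_ker_pairForm hε.pow_eq_one hfa, Fintype.sum_prod_type] at reduction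
    simp only [zmodChar_eq_expo] at reduction
    rw [← reduction, Finset.sum_mul_sum]
    refine Finset.sum_congr rfl fun x _ => Finset.sum_congr rfl fun y _ => ?_
    rw [smul_mul_smul_comm, representation_mul_vec hρε, smul_smul, pairForm_apply, expo_add,
      expo_add]
    rfl
  rw [weilOp_eq_sum hfa hε hρε, weilOp_eq_sum hfa hε hρε, weilOp_eq_sum hfa hε hρε,
    smul_mul_smul_comm, sum_mul_sum, smul_smul, smul_smul, factorSet]
  congr 1
  have card_ne_zero := natCast_card_ne_zero hε (image (g * h))
  field_simp

theorem weilOp_one (hε : IsPrimitiveRoot ε p) : weilOp ρ 1 = 1 := by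
  have card_V : (Fintype.card V : K) ≠ 0 :=
    Nat.card_eq_fintype_card (α := V) ▸ natCast_card_ne_zero hε V
  have apply_one (y : V) :
      ρ ⟨y, 0⟩ * ρ (⟨act (1 : isometryGroup f) y, 0⟩ : Extraspecial f)⁻¹ = 1 := by
    rw [← map_mul]
    exact (congrArg ρ (mul_inv_cancel _)).trans (map_one ρ)
  rw [weilOp]
  simp only [apply_one, Finset.sum_const, Finset.card_univ, ← Nat.cast_smul_eq_nsmul K,
    inv_smul_smul₀ card_V]

theorem isUnit_weilOp (hp : Odd p) (hf : f.Nondegenerate) (hfa : f.IsAlt)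
    (hε : IsPrimitiveRoot ε p)
    (hρε : ∀ z : ZMod p, ρ ⟨0, z⟩ = expo ε z • (1 : Module.End K V')) (g : isometryGroup f) :
    IsUnit (weilOp ρ g) := by
  have factorSet_ne_zero (k l : isometryGroup f) : factorSet ε k l ≠ 0 := by
    rw [factorSet_eq hp hf hfa hε]
    exact mul_ne_zero (mul_ne_zero (splitting_ne_zero hp hf hε _) (splitting_ne_zero hp hf hε _))
      (inv_ne_zero (splitting_ne_zero hp hf hε _))
  refine isUnit_iff_exists_and_exists.2
    ⟨⟨(factorSet ε g g⁻¹)⁻¹ • weilOp ρ g⁻¹, ?_⟩, ⟨(factorSet ε g⁻¹ g)⁻¹ • weilOp ρ g⁻¹, ?_⟩⟩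
  · rw [mul_smul_comm, weilOp_mul_weilOp hp hf hfa hε hρε, mul_inv_cancel, weilOp_one hε,
      inv_smul_smul₀ (factorSet_ne_zero _ _)]
  · rw [smul_mul_assoc, weilOp_mul_weilOp hp hf hfa hε hρε, inv_mul_cancel, weilOp_one hε,
      inv_smul_smul₀ (factorSet_ne_zero _ _)]

end WeilOperators

end Weil

theorem mainTheorem1_general {p : ℕ} [Fact p.Prime] (hp : Odd p)
    {V : Type*} [AddCommGroup V] [Module (ZMod p) V] [Fintype V]
    (f : LinearMap.BilinForm (ZMod p) V) (hf : f.Nondegenerate) (hfalt : f.IsAlt)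
    {K V' : Type*} [Field K] [AddCommGroup V'] [Module K V']
    (ρ : Representation K (Weil.Extraspecial f) V')
    (ε : K) (hε : IsPrimitiveRoot ε p)
    (hρε : ∀ z : ZMod p, ρ ⟨0, z⟩ = Weil.expo ε z • (1 : Module.End K V')) :
    ((∀ g : Weil.isometryGroup f, IsUnit (Weil.weilOp ρ g)) ∧
      ∀ g h : Weil.isometryGroup f,
        Weil.weilOp ρ g * Weil.weilOp ρ h = Weil.factorSet ε g h • Weil.weilOp ρ (g * h)) ∧
    ((∀ g : Weil.isometryGroup f, Weil.splitting ε g ≠ 0) ∧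
      ∀ g h : Weil.isometryGroup f,
        Weil.factorSet ε g h =
          Weil.splitting ε g * Weil.splitting ε h * (Weil.splitting ε (g * h))⁻¹) ∧
    (∀ η : K ≃+* K, η ε = ε⁻¹ →
      ∀ g : Weil.isometryGroup f, Weil.splitting ε g = η (Weil.splitting ε g⁻¹)) :=
  ⟨⟨Weil.isUnit_weilOp hp hf hfalt hε hρε, Weil.weilOp_mul_weilOp hp hf hfalt hε hρε⟩,
    ⟨Weil.splitting_ne_zero hp hf hε, Weil.factorSet_eq hp hf hfalt hε⟩,
    fun η => Weil.splitting_eq_map_inv hp hfalt hε (η : K →+* K)⟩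

theorem mainTheorem1 {p : ℕ} [Fact p.Prime] (hp : Odd p)
    {V : Type*} [AddCommGroup V] [Module (ZMod p) V] [Fintype V]
    (f : LinearMap.BilinForm (ZMod p) V) (hf : f.Nondegenerate) (hfalt : f.IsAlt)
    (n : ℕ) (hn : Module.finrank (ZMod p) V = 2 * n)
    {K V' : Type*} [Field K] [AddCommGroup V'] [Module K V']
    (hV' : Module.finrank K V' = p ^ n)
    (ρ : Representation K (Weil.Extraspecial f) V') (hρ : Weil.IsAbsolutelyIrreducible ρ)
    (ε : K) (hε : IsPrimitiveRoot ε p)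
    (hρε : ∀ z : ZMod p, ρ ⟨0, z⟩ = Weil.expo ε z • (1 : Module.End K V')) :
    -- `σ` is the factor set of the projective representation `g ↦ s(g)`
    ((∀ g : Weil.isometryGroup f, IsUnit (Weil.weilOp ρ g)) ∧
      ∀ g h : Weil.isometryGroup f,
        Weil.weilOp ρ g * Weil.weilOp ρ h = Weil.factorSet ε g h • Weil.weilOp ρ (g * h)) ∧
    -- `μ` splits `σ`
    ((∀ g : Weil.isometryGroup f, Weil.splitting ε g ≠ 0) ∧
      ∀ g h : Weil.isometryGroup f,
        Weil.factorSet ε g h =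
          Weil.splitting ε g * Weil.splitting ε h * (Weil.splitting ε (g * h))⁻¹) ∧
    -- compatibility with the automorphisms that invert `ε`
    (∀ η : K ≃+* K, η ε = ε⁻¹ →
      ∀ g : Weil.isometryGroup f, Weil.splitting ε g = η (Weil.splitting ε g⁻¹)) := by
  exact mainTheorem1_general hp f hf hfalt ρ ε hε hρε
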